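/- Let $(M^n,g)$ be a Riemannian manifold, let $(\overline M^{n+1},\overline g)$ be a semi-Riemannian manifold, and let $f:M\to\overline M$ be an isometric immersion with a smooth field $N$ of unit normal vectors along $f$; write $\epsilon_N=\overline g(N,N)=\pm1$. Let $\mathcal A$ be the Weingarten operator, $\mathcal A X=-(\overline\nabla_X N)^{\top}$, where $\overline\nabla$ is the Levi-Civita connection of $\overline g$, regarded also as the $(0,2)$-tensor $(X,Y)\mapsto g(\mathcal A X,Y)$. Let $\overline V$ be a conformal vector field on $\overline M$ with smooth conformal factor $\sigma$, i.e. $\mathcal L_{\overline V}\overline g=2\sigma\overline g$; let $V$ be the tangential part of $\overline V$ along $f$, a vector field on $M$, and let $C=\overline g(\overline V\circ f,N)$ be the angle function. Let $\lambda:M\to\mathbb R$ be a function, and put $\psi=\sigma\circ f-\lambda$. Then $V$ gives a Ricci almost soliton structure on $M$ with soliton function $\lambda$, i.e. $V$ is a smooth vector field with $$Ric+\tfrac12\mathcal L_V g=\lambda g,$$ if and only if $$Ric=-\psi\, g-\epsilon_N\, C\,\mathcal A .$$ -/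

import Mathlib

open scoped Manifold ContDiff
open Bundle VectorField

set_option linter.unusedSectionVars false

noncomputable section

namespace SemiRiemannian

section OneManifold

variable {E : Type*} [NormedAddCommGroup E] [NormedSpace ℝ E] [FiniteDimensional ℝ E]
  {H : Type*} [TopologicalSpace H] {I : ModelWithCorners ℝ E H}
  {M : Type*} [TopologicalSpace M] [ChartedSpace H M] [IsManifold I ∞ M]

instance finiteDimensional_tangentSpace (x : M) : FiniteDimensional ℝ (TangentSpace I x) :=
  inferInstanceAs (FiniteDimensional ℝ E)

instance t2Space_tangentSpace (x : M) : T2Space (TangentSpace I x) :=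
  inferInstanceAs (T2Space E)

variable (I M) in
/-- A semi-Riemannian metric on `M`: a smooth field of symmetric nondegenerate bilinear forms on
the tangent spaces. -/
structure Metric where
  /-- The scalar product on the tangent space at `x`. -/
  inner (x : M) : TangentSpace I x →L[ℝ] TangentSpace I x →L[ℝ] ℝ
  symm (x : M) (v w : TangentSpace I x) : inner x v w = inner x w v
  nondegenerate (x : M) (v : TangentSpace I x) (hv : ∀ w, inner x v w = 0) : v = 0
  contMDiff : ContMDiff I (I.prod 𝓘(ℝ, E →L[ℝ] E →L[ℝ] ℝ)) ∞
    (fun x ↦ TotalSpace.mk' (E →L[ℝ] E →L[ℝ] ℝ)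
      (E := fun x : M ↦ TangentSpace I x →L[ℝ] TangentSpace I x →L[ℝ] ℝ) x (inner x))

/-- A smooth Riemannian metric, seen as a semi-Riemannian metric. -/
def Metric.ofRiemannian
    (g : ContMDiffRiemannianMetric I ∞ E (TangentSpace I : M → Type _)) : Metric I M where
  inner := g.inner
  symm := g.symm
  nondegenerate x v hv := by
    by_contra h
    exact (g.pos x v h).ne' (hv v)
  contMDiff := g.contMDiff

namespace Metric

variable (g : Metric I M)

lemma mdifferentiableAt_inner {Y Z : Π x : M, TangentSpace I x} {x : M}
    (hY : MDiffAt (T% Y) x) (hZ : MDiffAt (T% Z) x) :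
    MDiffAt (fun y ↦ g.inner y (Y y) (Z y)) x := by
  have : MDifferentiableAt I (I.prod 𝓘(ℝ))
      (fun m ↦ TotalSpace.mk' ℝ (E := Bundle.Trivial M ℝ) m (g.inner m (Y m) (Z m))) x := by
    apply MDifferentiableAt.clm_bundle_apply₂ (F₁ := E) (F₂ := E)
    · exact (g.contMDiff x).mdifferentiableAt (by simp)
    · exact hY
    · exact hZ
  simp only [mdifferentiableAt_totalSpace] at this
  exact this.2

/-- The isomorphism `v ↦ ⟨v, ·⟩` from the tangent space at `x` to its dual. -/
def flat (x : M) : TangentSpace I x ≃ₗ[ℝ] (TangentSpace I x →L[ℝ] ℝ) :=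
  LinearMap.linearEquivOfInjective (g.inner x : TangentSpace I x →ₗ[ℝ] _)
    ((injective_iff_map_eq_zero _).2 fun v hv ↦
      g.nondegenerate x v fun w ↦ by simpa using congr($hv w))
    ((Subspace.dual_finrank_eq (K := ℝ) (V := TangentSpace I x)).symm.trans
      (LinearMap.toContinuousLinearMap
        (𝕜 := ℝ) (E := TangentSpace I x) (F' := ℝ)).finrank_eq)

/-- The metric dual of a covector at `x`, i.e. the inverse of `v ↦ ⟨v, ·⟩`. -/
def sharp (x : M) : (TangentSpace I x →L[ℝ] ℝ) →L[ℝ] TangentSpace I x :=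
  LinearMap.toContinuousLinearMap ((g.flat x).symm : _ →ₗ[ℝ] TangentSpace I x)

@[simp]
lemma inner_sharp (x : M) (φ : TangentSpace I x →L[ℝ] ℝ) (v : TangentSpace I x) :
    g.inner x (g.sharp x φ) v = φ v :=
  congr($((g.flat x).apply_symm_apply φ) v)

lemma ext_inner {x : M} {v w : TangentSpace I x} (h : ∀ z, g.inner x v z = g.inner x w z) :
    v = w :=
  sub_eq_zero.1 (g.nondegenerate x _ fun z ↦ by simp [h z])

/-! ### The Levi-Civita connection -/

/-- The right-hand side of the Koszul formula, an expression for `2 ⟨∇_X Y, Z⟩`. -/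
def koszul (X Y Z : Π x : M, TangentSpace I x) (x : M) : ℝ :=
  d% (fun y ↦ g.inner y (Y y) (Z y)) x (X x) + d% (fun y ↦ g.inner y (Z y) (X y)) x (Y x)
    - d% (fun y ↦ g.inner y (X y) (Y y)) x (Z x)
    - g.inner x (X x) (mlieBracket I Y Z x) + g.inner x (Y x) (mlieBracket I Z X x)
    + g.inner x (Z x) (mlieBracket I X Y x)

variable {g} in
lemma mvfderiv_inner_smul_left {f : M → ℝ} {Y Z : Π x : M, TangentSpace I x} {x : M}
    (hf : MDiffAt f x) (hY : MDiffAt (T% Y) x) (hZ : MDiffAt (T% Z) x) :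
    d% (fun y ↦ g.inner y ((f • Y) y) (Z y)) x
      = f x • d% (fun y ↦ g.inner y (Y y) (Z y)) x + g.inner x (Y x) (Z x) • d% f x := by
  rw [← mvfderiv_fun_mul hf (g.mdifferentiableAt_inner hY hZ)]
  simp

variable {g} in
lemma mvfderiv_inner_smul_right {f : M → ℝ} {Y Z : Π x : M, TangentSpace I x} {x : M}
    (hf : MDiffAt f x) (hY : MDiffAt (T% Y) x) (hZ : MDiffAt (T% Z) x) :
    d% (fun y ↦ g.inner y (Y y) ((f • Z) y)) x
      = f x • d% (fun y ↦ g.inner y (Y y) (Z y)) x + g.inner x (Y x) (Z x) • d% f x := by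
  rw [← mvfderiv_fun_mul hf (g.mdifferentiableAt_inner hY hZ)]
  simp

variable {g} in
lemma mvfderiv_inner_add_left {Y Y' Z : Π x : M, TangentSpace I x} {x : M}
    (hY : MDiffAt (T% Y) x) (hY' : MDiffAt (T% Y') x) (hZ : MDiffAt (T% Z) x) :
    d% (fun y ↦ g.inner y ((Y + Y') y) (Z y)) x
      = d% (fun y ↦ g.inner y (Y y) (Z y)) x + d% (fun y ↦ g.inner y (Y' y) (Z y)) x := by
  rw [← mvfderiv_fun_add (g.mdifferentiableAt_inner hY hZ) (g.mdifferentiableAt_inner hY' hZ)]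
  simp

variable {g} in
lemma mvfderiv_inner_add_right {Y Z Z' : Π x : M, TangentSpace I x} {x : M}
    (hY : MDiffAt (T% Y) x) (hZ : MDiffAt (T% Z) x) (hZ' : MDiffAt (T% Z') x) :
    d% (fun y ↦ g.inner y (Y y) ((Z + Z') y)) x
      = d% (fun y ↦ g.inner y (Y y) (Z y)) x + d% (fun y ↦ g.inner y (Y y) (Z' y)) x := by
  rw [← mvfderiv_fun_add (g.mdifferentiableAt_inner hY hZ) (g.mdifferentiableAt_inner hY hZ')]
  simp

lemma koszul_tensorial_left {Y Z : Π x : M, TangentSpace I x} {x : M}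
    (hY : MDiffAt (T% Y) x) (hZ : MDiffAt (T% Z) x) :
    TensorialAt I E (fun X ↦ g.koszul X Y Z x) x where
  smul {f X} hf hX := by
    simp only [koszul, mvfderiv_inner_smul_left hf hX hY, mvfderiv_inner_smul_right hf hZ hX,
      mlieBracket_smul_left hf hX, mlieBracket_smul_right hf hX]
    simp [g.symm x (Z x) (X x), g.symm x (Y x) (X x)]
    ring
  add {X X'} hX hX' := by
    simp only [koszul, mvfderiv_inner_add_left hX hX' hY, mvfderiv_inner_add_right hZ hX hX',
      mlieBracket_add_left hX hX', mlieBracket_add_right hX hX']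
    simp
    ring

lemma koszul_tensorial_right {X Y : Π x : M, TangentSpace I x} {x : M}
    (hX : MDiffAt (T% X) x) (hY : MDiffAt (T% Y) x) :
    TensorialAt I E (fun Z ↦ g.koszul X Y Z x) x where
  smul {f Z} hf hZ := by
    simp only [koszul, mvfderiv_inner_smul_left hf hZ hX, mvfderiv_inner_smul_right hf hY hZ,
      mlieBracket_smul_left hf hZ, mlieBracket_smul_right hf hZ]
    simp [g.symm x (Y x) (Z x), g.symm x (X x) (Z x)]
    ring
  add {Z Z'} hZ hZ' := by
    simp only [koszul, mvfderiv_inner_add_left hZ hZ' hX, mvfderiv_inner_add_right hY hZ hZ',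
      mlieBracket_add_left hZ hZ', mlieBracket_add_right hZ hZ']
    simp
    ring

/-- For differentiable `Y`, the bilinear form `(u, v) ↦ 2 ⟨∇_u Y, v⟩` at `x` given by the Koszul
formula. -/
def koszulForm (Y : Π x : M, TangentSpace I x) (x : M) (hY : MDiffAt (T% Y) x) :
    TangentSpace I x →L[ℝ] TangentSpace I x →L[ℝ] ℝ :=
  TensorialAt.mkHom₂ (F := E) (F' := E) (fun X Z ↦ g.koszul X Y Z x) x
    (fun _ hZ ↦ g.koszul_tensorial_left hY hZ) (fun _ hX ↦ g.koszul_tensorial_right hX hY)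

lemma koszulForm_apply {X Y Z : Π x : M, TangentSpace I x} {x : M}
    (hX : MDiffAt (T% X) x) (hY : MDiffAt (T% Y) x) (hZ : MDiffAt (T% Z) x) :
    g.koszulForm Y x hY (X x) (Z x) = g.koszul X Y Z x :=
  TensorialAt.mkHom₂_apply _ _ hX hZ

open scoped Classical in
/-- The Levi-Civita connection, as a function. -/
def leviCivitaFun (Y : Π x : M, TangentSpace I x) (x : M) :
    TangentSpace I x →L[ℝ] TangentSpace I x :=
  if hY : MDiffAt (T% Y) x then (1 / 2 : ℝ) • (g.sharp x ∘L g.koszulForm Y x hY) else 0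

lemma inner_leviCivitaFun {X Y Z : Π x : M, TangentSpace I x} {x : M}
    (hX : MDiffAt (T% X) x) (hY : MDiffAt (T% Y) x) (hZ : MDiffAt (T% Z) x) :
    g.inner x (g.leviCivitaFun Y x (X x)) (Z x) = 1 / 2 * g.koszul X Y Z x := by
  simp [leviCivitaFun, hY, koszulForm_apply g hX hY hZ]

lemma leviCivitaFun_ext {x : M} {A B : TangentSpace I x →L[ℝ] TangentSpace I x}
    (h : ∀ X Z : Π x : M, TangentSpace I x, MDiffAt (T% X) x → MDiffAt (T% Z) x →
      g.inner x (A (X x)) (Z x) = g.inner x (B (X x)) (Z x)) : A = B := by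
  ext u
  refine g.ext_inner fun z ↦ ?_
  simpa using h (FiberBundle.extend E u) (FiberBundle.extend E z)
    (FiberBundle.mdifferentiableAt_extend ..) (FiberBundle.mdifferentiableAt_extend ..)

/-- The Levi-Civita connection of a semi-Riemannian metric, given by the Koszul formula.
It is the torsion-free connection compatible with the metric, see
`torsion_leviCivita` and `mvfderiv_inner_leviCivita`. -/
def leviCivita : CovariantDerivative I E (TangentSpace I : M → Type _) where
  toFun := g.leviCivitaFun
  isCovariantDerivativeOnUniv :=
    { add := by
        intro Y Y' x hY hY' _
        refine g.leviCivitaFun_ext fun X Z hX hZ ↦ ?_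
        have h := inner_leviCivitaFun g hX hY hZ
        have h' := inner_leviCivitaFun g hX hY' hZ
        have h'' := inner_leviCivitaFun g hX (mdifferentiableAt_add_section hY hY') hZ
        simp only [add_apply, map_add, h, h']
        refine h''.trans ?_
        simp only [koszul, mvfderiv_inner_add_left hY hY' hZ, mvfderiv_inner_add_right hX hY hY',
          mlieBracket_add_left hY hY', mlieBracket_add_right hY hY']
        simp
        ring
      leibniz := by
        intro Y f x hY hf _
        refine g.leviCivitaFun_ext fun X Z hX hZ ↦ ?_
        have h := inner_leviCivitaFun g hX hY hZ
        have h'' := inner_leviCivitaFun g hX (hf.smul_section hY) hZ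
        simp only [add_apply, map_add, smul_apply,
          map_smul, h, ContinuousLinearMap.smulRight_apply]
        refine h''.trans ?_
        simp only [koszul, mvfderiv_inner_smul_left hf hY hZ, mvfderiv_inner_smul_right hf hX hY,
          mlieBracket_smul_left hf hY, mlieBracket_smul_right hf hY]
        simp [g.symm x (X x) (Y x), g.symm x (Z x) (Y x)]
        ring }

lemma inner_leviCivita {X Y Z : Π x : M, TangentSpace I x} {x : M}
    (hX : MDiffAt (T% X) x) (hY : MDiffAt (T% Y) x) (hZ : MDiffAt (T% Z) x) :
    g.inner x (g.leviCivita Y x (X x)) (Z x) = 1 / 2 * g.koszul X Y Z x :=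
  inner_leviCivitaFun g hX hY hZ

/-- The Levi-Civita connection is torsion-free. -/
lemma torsion_leviCivita {X Y : Π x : M, TangentSpace I x} {x : M}
    (hX : MDiffAt (T% X) x) (hY : MDiffAt (T% Y) x) :
    g.leviCivita Y x (X x) - g.leviCivita X x (Y x) = mlieBracket I X Y x := by
  refine g.ext_inner fun z ↦ ?_
  have hZ := FiberBundle.mdifferentiableAt_extend I E z
  have h := inner_leviCivita g hX hY hZ
  have h' := inner_leviCivita g hY hX hZ
  simp only [FiberBundle.extend_apply_self] at h h'
  simp only [map_sub, sub_apply, h, h', koszul, FiberBundle.extend_apply_self]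
  have e1 : ∀ A B : Π x : M, TangentSpace I x, (fun y ↦ g.inner y (A y) (B y)) =
      fun y ↦ g.inner y (B y) (A y) := fun A B ↦ funext fun y ↦ g.symm y _ _
  rw [e1 (FiberBundle.extend E z) X, e1 (FiberBundle.extend E z) Y, e1 Y X,
    mlieBracket_swap_apply (V := Y) (W := X), mlieBracket_swap_apply (V := FiberBundle.extend E z)
    (W := X), mlieBracket_swap_apply (V := FiberBundle.extend E z)
    (W := Y), g.symm x _ z]
  simp
  ring

/-- The Levi-Civita connection is compatible with the metric. -/
lemma mvfderiv_inner_leviCivita {X Y Z : Π x : M, TangentSpace I x} {x : M}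
    (hX : MDiffAt (T% X) x) (hY : MDiffAt (T% Y) x) (hZ : MDiffAt (T% Z) x) :
    d% (fun y ↦ g.inner y (Y y) (Z y)) x (X x)
      = g.inner x (g.leviCivita Y x (X x)) (Z x) + g.inner x (Y x) (g.leviCivita Z x (X x)) := by
  rw [g.symm x (Y x), inner_leviCivita g hX hY hZ, inner_leviCivita g hX hZ hY]
  simp only [koszul]
  have e1 : ∀ A B : Π x : M, TangentSpace I x, (fun y ↦ g.inner y (A y) (B y)) =
      fun y ↦ g.inner y (B y) (A y) := fun A B ↦ funext fun y ↦ g.symm y _ _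
  rw [e1 Z X, e1 Z Y, e1 Y X, mlieBracket_swap_apply (V := Z) (W := Y),
    mlieBracket_swap_apply (V := Z) (W := X), mlieBracket_swap_apply (V := Y) (W := X)]
  simp
  ring

/-! ### Curvature -/

/-- The curvature `R(X, Y) Z = ∇_X ∇_Y Z - ∇_Y ∇_X Z - ∇_{[X, Y]} Z` of the Levi-Civita
connection. -/
def curvature (X Y Z : Π x : M, TangentSpace I x) (x : M) : TangentSpace I x :=
  g.leviCivita (fun y ↦ g.leviCivita Z y (Y y)) x (X x)
    - g.leviCivita (fun y ↦ g.leviCivita Z y (X y)) x (Y x)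
    - g.leviCivita Z x (mlieBracket I X Y x)

/-- The Ricci tensor `Ric(u, v) = tr (w ↦ R(w, u) v)`. The trace is computed in a basis `b` of the
tangent space at `x`; to evaluate the tensor `R` at `x`, the tangent vectors at `x` are extended to
vector fields that are smooth near `x` (those with constant components in the chart at `x`). The
sign is the one for which round spheres have positive Ricci curvature. -/
def ricci (x : M) (u v : TangentSpace I x) : ℝ :=
  let b : Module.Basis (Fin (Module.finrank ℝ (TangentSpace I x))) ℝ (TangentSpace I x) :=
    Module.finBasis ℝ (TangentSpace I x)
  ∑ i, b.repr (g.curvature (FiberBundle.extend E (b i)) (FiberBundle.extend E u)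
    (FiberBundle.extend E v) x) i

/-! ### Lie derivatives of the metric -/

/-- The expression `X ⟨Y, Z⟩ - ⟨[X, Y], Z⟩ - ⟨Y, [X, Z]⟩`. -/
def lieDerivAux (X Y Z : Π x : M, TangentSpace I x) (x : M) : ℝ :=
  d% (fun y ↦ g.inner y (Y y) (Z y)) x (X x)
    - g.inner x (mlieBracket I X Y x) (Z x) - g.inner x (Y x) (mlieBracket I X Z x)

lemma lieDerivAux_tensorial_left (X : Π x : M, TangentSpace I x) {Z : Π x : M, TangentSpace I x}
    {x : M} (hZ : MDiffAt (T% Z) x) :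
    TensorialAt I E (fun Y ↦ g.lieDerivAux X Y Z x) x where
  smul {f Y} hf hY := by
    simp only [lieDerivAux, mvfderiv_inner_smul_left hf hY hZ, mlieBracket_smul_right hf hY]
    simp
    ring
  add {Y Y'} hY hY' := by
    simp only [lieDerivAux, mvfderiv_inner_add_left hY hY' hZ, mlieBracket_add_right hY hY']
    simp
    ring

lemma lieDerivAux_tensorial_right (X : Π x : M, TangentSpace I x) {Y : Π x : M, TangentSpace I x}
    {x : M} (hY : MDiffAt (T% Y) x) :
    TensorialAt I E (fun Z ↦ g.lieDerivAux X Y Z x) x where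
  smul {f Z} hf hZ := by
    simp only [lieDerivAux, mvfderiv_inner_smul_right hf hY hZ, mlieBracket_smul_right hf hZ]
    simp
    ring
  add {Z Z'} hZ hZ' := by
    simp only [lieDerivAux, mvfderiv_inner_add_right hY hZ hZ', mlieBracket_add_right hZ hZ']
    simp
    ring

/-- The Lie derivative `L_X g`: the tensor with
`(L_X g)(Y, Z) = X ⟨Y, Z⟩ - ⟨[X, Y], Z⟩ - ⟨Y, [X, Z]⟩`. -/
def lieDeriv (X : Π x : M, TangentSpace I x) (x : M) :
    TangentSpace I x →L[ℝ] TangentSpace I x →L[ℝ] ℝ :=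
  TensorialAt.mkHom₂ (F := E) (F' := E) (fun Y Z ↦ g.lieDerivAux X Y Z x) x
    (fun _ hZ ↦ g.lieDerivAux_tensorial_left X hZ) (fun _ hY ↦ g.lieDerivAux_tensorial_right X hY)

lemma lieDeriv_apply (X : Π x : M, TangentSpace I x) {Y Z : Π x : M, TangentSpace I x} {x : M}
    (hY : MDiffAt (T% Y) x) (hZ : MDiffAt (T% Z) x) :
    g.lieDeriv X x (Y x) (Z x) = d% (fun y ↦ g.inner y (Y y) (Z y)) x (X x)
      - g.inner x (mlieBracket I X Y x) (Z x) - g.inner x (Y x) (mlieBracket I X Z x) :=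
  TensorialAt.mkHom₂_apply _ _ hY hZ

end Metric

/-- `X` is a conformal field with conformal factor `σ`: `X` is a smooth vector field, `σ` a smooth function, and `L_X g = 2 σ g`. -/
structure IsConformalField (g : Metric I M) (X : Π x : M, TangentSpace I x) (σ : M → ℝ) :
    Prop where
  contMDiff_field : CMDiff ∞ (T% X)
  contMDiff_factor : CMDiff ∞ σ
  lieDeriv_eq (x : M) (u v : TangentSpace I x) : g.lieDeriv X x u v = 2 * σ x * g.inner x u v

/-- `X` gives a Ricci almost soliton structure with soliton function `lam`: `X` is a smooth vector
field and `Ric + (1/2) L_X g = lam g`. -/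
structure IsRicciAlmostSoliton (g : Metric I M) (X : Π x : M, TangentSpace I x) (lam : M → ℝ) :
    Prop where
  contMDiff_field : CMDiff ∞ (T% X)
  ricci_add_lieDeriv (x : M) (u v : TangentSpace I x) :
    g.ricci x u v + 1 / 2 * g.lieDeriv X x u v = lam x * g.inner x u v

end OneManifold

section Immersion

variable {E : Type*} [NormedAddCommGroup E] [NormedSpace ℝ E] [FiniteDimensional ℝ E]
  {H : Type*} [TopologicalSpace H] {I : ModelWithCorners ℝ E H}
  {M : Type*} [TopologicalSpace M] [ChartedSpace H M] [IsManifold I ∞ M]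
  {E' : Type*} [NormedAddCommGroup E'] [NormedSpace ℝ E'] [FiniteDimensional ℝ E']
  {H' : Type*} [TopologicalSpace H'] {I' : ModelWithCorners ℝ E' H'}
  {M' : Type*} [TopologicalSpace M'] [ChartedSpace H' M'] [IsManifold I' ∞ M']

/-- `f : (M, g) → (M', g')` is an isometric immersion: it is smooth and `f^* g' = g`. Since `g` is
nondegenerate, this implies that the differential of `f` is injective everywhere. -/
structure IsIsometricImmersion (g : Metric I M) (g' : Metric I' M') (f : M → M') : Prop where
  contMDiff : ContMDiff I I' ∞ f
  inner_mfderiv (x : M) (u v : TangentSpace I x) :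
    g'.inner (f x) (mfderiv I I' f x u) (mfderiv I I' f x v) = g.inner x u v

lemma IsIsometricImmersion.injective_mfderiv {g : Metric I M} {g' : Metric I' M'} {f : M → M'}
    (hf : IsIsometricImmersion g g' f) (x : M) : Function.Injective (mfderiv I I' f x) := by
  refine (injective_iff_map_eq_zero (mfderiv I I' f x)).2 fun u hu ↦ g.nondegenerate x u fun v ↦ ?_
  rw [← hf.inner_mfderiv, hu]
  simp

/-- `N` is a smooth field of unit normal vectors along the map `f : M → M'`. -/
structure IsUnitNormal (g' : Metric I' M') (f : M → M') (N : Π x : M, TangentSpace I' (f x)) :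
    Prop where
  contMDiff : ContMDiff I I'.tangent ∞ (fun x ↦ (⟨f x, N x⟩ : TangentBundle I' M'))
  inner_mfderiv (x : M) (u : TangentSpace I x) : g'.inner (f x) (N x) (mfderiv I I' f x u) = 0
  inner_self (x : M) : g'.inner (f x) (N x) (N x) = 1 ∨ g'.inner (f x) (N x) (N x) = -1

variable (I) in
/-- The covariant derivative along `f : M → M'` of a vector field `W` along `f`, induced by a
connection `∇` on `M'`. If `e` is the coordinate frame at `f x` and `W = ∑ Wⁱ (eᵢ ∘ f)`, then
`∇_u W = ∑ dWⁱ(u) eᵢ + ∑ Wⁱ ∇_{df(u)} eᵢ` at `x`. -/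
def covAlong (cov : CovariantDerivative I' E' (TangentSpace I' : M' → Type _)) (f : M → M')
    (W : Π x : M, TangentSpace I' (f x)) (x : M) : TangentSpace I x →L[ℝ] TangentSpace I' (f x) :=
  let e := trivializationAt E' (TangentSpace I' : M' → Type _) (f x)
  e.symmL ℝ (f x) ∘L mvfderiv I (fun z ↦ (e ⟨f z, W z⟩).2) x
    + cov (FiberBundle.extend E' (W x)) (f x) ∘L mfderiv I I' f x

/-- A connection expressed through the derivative of the components of a vector field. -/
lemma covAlong_aux (cov : CovariantDerivative I' E' (TangentSpace I' : M' → Type _))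
    {Y : Π y : M', TangentSpace I' y} {y : M'} (hY : MDiffAt (T% Y) y) :
    let e := trivializationAt E' (TangentSpace I' : M' → Type _) y
    cov Y y = e.symmL ℝ y ∘L mvfderiv I' (fun z ↦ (e ⟨z, Y z⟩).2) y
      + cov (FiberBundle.extend E' (Y y)) y := by
  intro e
  have hy : y ∈ e.baseSet := FiberBundle.mem_baseSet_trivializationAt' y
  have hd : ∀ {Z : Π y : M', TangentSpace I' y}, MDiffAt (T% Z) y →
      MDiffAt (fun z ↦ (e ⟨z, Z z⟩).2) y := fun hZ ↦ mdifferentiableAt_section .. |>.1 hZ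
  have hadd : ∀ {Z : Π y : M', TangentSpace I' y} {Z' : Π y : M', TangentSpace I' y},
      (fun z ↦ (e ⟨z, (Z + Z') z⟩).2) =ᶠ[nhds y]
        (fun z ↦ (e ⟨z, Z z⟩).2 + (e ⟨z, Z' z⟩).2) := by
    intro Z Z'
    filter_upwards [e.open_baseSet.mem_nhds hy] with z hz
    exact (e.linear ℝ hz).map_add _ _
  have hsmul : ∀ {c : M' → ℝ} {Z : Π y : M', TangentSpace I' y},
      (fun z ↦ (e ⟨z, (c • Z) z⟩).2) =ᶠ[nhds y] (fun z ↦ c z • (e ⟨z, Z z⟩).2) := by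
    intro c Z
    filter_upwards [e.open_baseSet.mem_nhds hy] with z hz
    exact (e.linear ℝ hz).map_smul _ _
  have key : TensorialAt I' E' (fun Z : Π y : M', TangentSpace I' y ↦
      cov Z y - e.symmL ℝ y ∘L mvfderiv I' (fun z ↦ (e ⟨z, Z z⟩).2) y) y :=
    { smul := by
        intro c Z hc hZ
        have h1 : mvfderiv I' (fun z ↦ (e ⟨z, (c • Z) z⟩).2) y
            = mvfderiv I' (fun z ↦ c z • (e ⟨z, Z z⟩).2) y := by
          simp only [mvfderiv, hsmul.mfderiv_eq]
          rfl
        have h2 : e.symmL ℝ y (e ⟨y, Z y⟩).2 = Z y :=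
          (e.symmL_apply hy _).trans (e.symm_apply_apply_mk hy (Z y))
        rw [h1, mvfderiv_fun_smul hc (hd hZ), cov.isCovariantDerivativeOnUniv.leibniz hZ hc]
        ext u
        have h3 : ∀ r : ℝ, e.symmL ℝ y (r • (e ⟨y, Z y⟩).2) = r • Z y := fun r ↦ by
          rw [map_smul, h2]
        simp only [sub_apply, add_apply, smul_apply, ContinuousLinearMap.comp_apply, map_add,
          ContinuousLinearMap.smulRight_apply, h3, map_smul]
        module
      add := by
        intro Z Z' hZ hZ'
        have h1 : mvfderiv I' (fun z ↦ (e ⟨z, (Z + Z') z⟩).2) y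
            = mvfderiv I' (fun z ↦ (e ⟨z, Z z⟩).2 + (e ⟨z, Z' z⟩).2) y := by
          simp only [mvfderiv, hadd.mfderiv_eq]
          rfl
        rw [h1, mvfderiv_fun_add (hd hZ) (hd hZ'), cov.isCovariantDerivativeOnUniv.add hZ hZ']
        ext u
        simp
        module }
  have h := key.pointwise hY (FiberBundle.mdifferentiableAt_extend I' E' (Y y)) (by simp)
  have h0 : mvfderiv I' (fun z ↦ (e ⟨z, FiberBundle.extend E' (Y y) z⟩).2) y = 0 := by
    have : (fun z ↦ (e ⟨z, FiberBundle.extend E' (Y y) z⟩).2) =ᶠ[nhds y]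
        fun _ ↦ (e ⟨y, Y y⟩).2 := by
      filter_upwards [e.open_baseSet.mem_nhds hy] with z hz
      exact congr($(e.apply_mk_symm hz (e ⟨y, Y y⟩).2).2)
    simp only [mvfderiv, this.mfderiv_eq]
    simp
    rfl
  simp only [h0] at h
  rw [sub_eq_iff_eq_add] at h
  rw [h]
  simp
  abel

/-- If `W = Y ∘ f` for a vector field `Y` on `M'`, then `∇_u W = ∇_{df(u)} Y`. -/
lemma covAlong_comp (cov : CovariantDerivative I' E' (TangentSpace I' : M' → Type _))
    {f : M → M'} {Y : Π y : M', TangentSpace I' y} {x : M} (hf : MDifferentiableAt I I' f x)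
    (hY : MDiffAt (T% Y) (f x)) :
    covAlong I cov f (fun z ↦ Y (f z)) x = cov Y (f x) ∘L mfderiv I I' f x := by
  ext u
  rw [covAlong_aux cov hY]
  have hd : MDiffAt (fun z ↦ (trivializationAt E' (TangentSpace I' : M' → Type _) (f x)
    ⟨z, Y z⟩).2) (f x) := mdifferentiableAt_section .. |>.1 hY
  simp only [covAlong]
  have h : mvfderiv I (fun z ↦ (trivializationAt E' (TangentSpace I' : M' → Type _) (f x)
      ⟨f z, Y (f z)⟩).2) x u = mvfderiv I' (fun z ↦ (trivializationAt E'
      (TangentSpace I' : M' → Type _) (f x) ⟨z, Y z⟩).2) (f x) (mfderiv I I' f x u) :=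
    mfderiv_comp_apply x hd hf u
  simp only [add_apply, ContinuousLinearMap.comp_apply, h]

/-- The tangential part of `w ∈ T_{f x} M'`: the vector `v ∈ T_x M` such that
`⟨v, u⟩ = ⟨w, df(u)⟩` for all `u`. -/
def tangentialPart (g : Metric I M) (g' : Metric I' M') (f : M → M') (x : M) :
    TangentSpace I' (f x) →L[ℝ] TangentSpace I x :=
  g.sharp x ∘L (ContinuousLinearMap.precomp ℝ (mfderiv I I' f x)) ∘L g'.inner (f x)

@[simp]
lemma inner_tangentialPart (g : Metric I M) (g' : Metric I' M') (f : M → M') (x : M)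
    (w : TangentSpace I' (f x)) (u : TangentSpace I x) :
    g.inner x (tangentialPart g g' f x w) u = g'.inner (f x) w (mfderiv I I' f x u) := by
  simp [tangentialPart]

/-- The Weingarten operator `A u = -(∇_u N)^⊤` of `f` with respect to the normal field `N`, where
`∇` is the Levi-Civita connection of the ambient manifold. -/
def weingarten (g : Metric I M) (g' : Metric I' M') (f : M → M')
    (N : Π x : M, TangentSpace I' (f x)) (x : M) : TangentSpace I x →L[ℝ] TangentSpace I x :=
  -(tangentialPart g g' f x ∘L covAlong I g'.leviCivita f N x)

/-- The angle function `C = ⟨X, N⟩` on `M`, for a vector field `X` on the ambient manifold. -/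
def angleFunction (g' : Metric I' M') (f : M → M') (N : Π x : M, TangentSpace I' (f x))
    (X : Π y : M', TangentSpace I' y) (x : M) : ℝ :=
  g'.inner (f x) (X (f x)) (N x)

end Immersion

end SemiRiemannian

end

/-! The Ricci tensor plays no role beyond being a fixed term: the equivalence is a substitution,
once `(1/2) L_V g = σ g + ε C A` is known for the tangential part `V` of the conformal field `X`
(`IsConformalField.half_lieDeriv_tangentialPart`).

To obtain this identity, write `X ∘ f = df(V) + ε C N` (`mfderiv_tangentialPart_add`; codimension
one enters here) and take the tangential part of the derivative, which gives `⟨∇_u X, df v⟩ = ⟨∇_u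
df(V), df v⟩ - ε C ⟨A u, v⟩` (`inner_leviCivita_mfderiv`). Symmetrized in `u` and `v`, the left side
is `L_X g' = 2 σ g'` on tangent vectors, the first term on the right is `L_V g`, and the last is `-2
ε C A`, because `A` is self-adjoint.

All derivatives are taken with the ambient connection along `f`; the Gauss formula is never needed.
What is needed is that this derivative is metric (`mvfderiv_inner_covAlong`) and torsion-free
(`covAlong_mfderiv_sub`). Both are checked in coordinates, the second by means of the identity `[X,
Y] h = X (Y h) - Y (X h)` (`mvfderiv_mlieBracket`). -/

noncomputable section

namespace SemiRiemannian

/-! ### Calculus of operator-valued maps on a manifold. -/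

section Calculus

variable {E : Type*} [NormedAddCommGroup E] [NormedSpace ℝ E] [FiniteDimensional ℝ E]
  {H : Type*} [TopologicalSpace H] {I : ModelWithCorners ℝ E H}
  {M : Type*} [TopologicalSpace M] [ChartedSpace H M] [IsManifold I ∞ M]
  {F : Type*} [NormedAddCommGroup F] [NormedSpace ℝ F]
  {G : Type*} [NormedAddCommGroup G] [NormedSpace ℝ G]

/-- A map into `F →L[ℝ] G` with `F` finite-dimensional is `C^n` if its evaluations are. -/
lemma contMDiffAt_clm_of_apply [FiniteDimensional ℝ F] {k : WithTop ℕ∞} {f : M → F →L[ℝ] G} {x : M}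
    (h : ∀ v, ContMDiffAt I 𝓘(ℝ, G) k (fun y ↦ f y v) x) :
    ContMDiffAt I 𝓘(ℝ, F →L[ℝ] G) k f x := by
  let b := Module.finBasis ℝ F
  -- An operator is the finite sum of the rank-one operators `bᵢ* ⊗ f(bᵢ)`, each linear in one
  -- evaluation.
  have hf : f = fun y ↦ ∑ i, ContinuousLinearMap.smulRightL ℝ F G
      (LinearMap.toContinuousLinearMap (b.coord i)) (f y (b i)) := by
    funext y
    ext v
    conv_lhs => rw [← b.sum_repr v]
    simp only [map_sum, map_smul, sum_apply, ContinuousLinearMap.smulRightL_apply_apply,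
      ContinuousLinearMap.smulRight_apply, LinearMap.coe_toContinuousLinearMap',
      Module.Basis.coord_apply]
  rw [hf]
  exact contMDiffAt_finsetSum fun i _ ↦
    ((ContinuousLinearMap.smulRightL ℝ F G
      (LinearMap.toContinuousLinearMap (b.coord i))).contMDiff.contMDiffAt).comp x (h (b i))

lemma mvfderiv_clm_apply {c : M → F →L[ℝ] G} {u : M → F} {x : M}
    (hc : MDifferentiableAt I 𝓘(ℝ, F →L[ℝ] G) c x) (hu : MDifferentiableAt I 𝓘(ℝ, F) u x)
    (w : TangentSpace I x) :
    mvfderiv I (fun y ↦ c y (u y)) x w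
      = mvfderiv I c x w (u x) + c x (mvfderiv I u x w) := by
  have hB := (isBoundedBilinearMap_apply (𝕜 := ℝ) (E := F) (F := G)).hasFDerivAt (c x, u x)
  -- The target carries the model of the normed space `(F →L[ℝ] G) × F`, not the product model, so
  -- as to compose with the Fréchet derivative of evaluation.
  have hcu : HasMFDerivAt I 𝓘(ℝ, (F →L[ℝ] G) × F) (fun y ↦ (c y, u y)) x
      ((mfderiv I 𝓘(ℝ, F →L[ℝ] G) c x).prod (mfderiv I 𝓘(ℝ, F) u x)) :=
    ⟨hc.hasMFDerivAt.1.prodMk hu.hasMFDerivAt.1, hc.hasMFDerivAt.2.prodMk hu.hasMFDerivAt.2⟩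
  have := (hB.hasMFDerivAt.comp x hcu).mfderiv
  have h2 := congr($this w)
  refine h2.trans ?_
  exact add_comm _ _

lemma mvfderiv_congr {u v : M → F} {x : M} (h : u =ᶠ[nhds x] v) :
    mvfderiv I u x = mvfderiv I v x := by
  simp only [mvfderiv, h.mfderiv_eq]
  rfl

end Calculus

/-! ### The Lie bracket as a commutator of derivations. -/

section Bracket

variable {E : Type*} [NormedAddCommGroup E] [NormedSpace ℝ E] [FiniteDimensional ℝ E]
  {H : Type*} [TopologicalSpace H] {I : ModelWithCorners ℝ E H} [I.Boundaryless]
  {M : Type*} [TopologicalSpace M] [ChartedSpace H M] [IsManifold I ∞ M]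
  {F : Type*} [NormedAddCommGroup F] [NormedSpace ℝ F]

/-- A vector field read in the chart at `x`. -/
lemma mpullbackWithin_extChartAt_symm_apply (Y : Π y : M, TangentSpace I y) {x z : M}
    (hz : z ∈ (extChartAt I x).source) :
    mpullbackWithin 𝓘(ℝ, E) I (extChartAt I x).symm Y (Set.range I) (extChartAt I x z)
      = mfderiv I 𝓘(ℝ, E) (extChartAt I x) z (Y z) := by
  have A : (extChartAt I x).symm (extChartAt I x z) = z := (extChartAt I x).left_inv hz
  have h1 : (mfderivWithin 𝓘(ℝ, E) I (extChartAt I x).symm (Set.range I)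
      (extChartAt I x z)).IsInvertible :=
    isInvertible_mfderivWithin_extChartAt_symm ((extChartAt I x).map_source hz)
  have h2 := mfderivWithin_extChartAt_symm_comp_mfderiv_extChartAt' (I := I) hz
  have h3 : mfderivWithin 𝓘(ℝ, E) I (extChartAt I x).symm (Set.range I) (extChartAt I x z)
      (mfderiv I 𝓘(ℝ, E) (extChartAt I x) z (Y z)) = Y z := congr($h2 (Y z))
  -- The values of `Y` at `φ.symm (φ z)` and at `z` lie in different fibres; they are compared in
  -- the common model `E`.
  have h4 : ∀ w, w = z → (Y w : E) = (Y z : E) := by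
    rintro _ rfl
    rfl
  rw [mpullbackWithin_apply, h1.inverse_apply_eq]
  exact (h4 _ A).trans h3.symm

/-- In the chart at `x` both iterated derivatives are a Hessian term plus a term in the derivative
of the field; the Hessian terms cancel by symmetry. It is applied with `h` a chart, and with `h` a
chart composed with an immersion. -/
lemma mvfderiv_mlieBracket {h : M → F} {X Y : Π y : M, TangentSpace I y} {x : M}
    (hh : ContMDiffAt I 𝓘(ℝ, F) 2 h x) (hX : MDiffAt (T% X) x) (hY : MDiffAt (T% Y) x) :
    mvfderiv I h x (mlieBracket I X Y x)
      = mvfderiv I (fun y ↦ mvfderiv I h y (Y y)) x (X x)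
        - mvfderiv I (fun y ↦ mvfderiv I h y (X y)) x (Y x) := by
  have hr : Set.range I = Set.univ := I.range_eq_univ
  set φ := extChartAt I x with hφ
  set K : E → F := h ∘ φ.symm with hK
  let hat : (Π y : M, TangentSpace I y) → E → E := fun Z ↦
    mpullbackWithin 𝓘(ℝ, E) I φ.symm Z (Set.range I)
  have hat_apply : ∀ Z : Π y : M, TangentSpace I y, ∀ z ∈ φ.source,
      hat Z (φ z) = mfderiv I 𝓘(ℝ, E) φ z (Z z) := fun Z z hz ↦
    mpullbackWithin_extChartAt_symm_apply Z hz
  have hat_diff : ∀ Z : Π y : M, TangentSpace I y, MDiffAt (T% Z) x →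
      DifferentiableAt ℝ (hat Z) (φ x) := by
    intro Z hZ
    have := (mdifferentiableWithinAt_univ.2 hZ).differentiableWithinAt_mpullbackWithin_vectorField
    rw [hr, Set.preimage_univ, Set.univ_inter, ← hr] at this
    exact (hr ▸ this : DifferentiableWithinAt ℝ (hat Z) Set.univ (φ x)).differentiableAt
      Filter.univ_mem
  have hKs : ContDiffAt ℝ 2 K (φ x) := by
    have := (contMDiffAt_iff.1 hh).2
    rw [hr, contDiffWithinAt_univ] at this
    exact this
  have hKd : ∀ᶠ z in nhds x, DifferentiableAt ℝ K (φ z) := by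
    have : ∀ᶠ p in nhds (φ x), DifferentiableAt ℝ K p := by
      filter_upwards [hKs.eventually (by simp)] with p hp
      exact hp.differentiableAt (by simp)
    exact (continuousAt_extChartAt x).eventually this
  have hdh : ∀ᶠ z in nhds x, z ∈ φ.source ∧ ∀ v : TangentSpace I z, mvfderiv I h z v
      = fderiv ℝ K (φ z) (mfderiv I 𝓘(ℝ, E) φ z v) := by
    filter_upwards [hKd, extChartAt_source_mem_nhds (I := I) x] with z hz hzs
    refine ⟨hzs, fun v ↦ ?_⟩
    have e : h =ᶠ[nhds z] K ∘ φ := by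
      filter_upwards [(isOpen_extChartAt_source (I := I) x).mem_nhds hzs] with y hy
      simp [hK, φ.left_inv hy]
    rw [mvfderiv_congr e]
    have h1 : HasMFDerivAt I 𝓘(ℝ, E) φ z (mfderiv I 𝓘(ℝ, E) φ z) :=
      (mdifferentiableAt_extChartAt (by simpa [hφ] using hzs)).hasMFDerivAt
    have := (hz.hasFDerivAt.hasMFDerivAt.comp z h1).mfderiv
    exact congr($this v)
  -- Product rule for `p ↦ DK(p)(hat Z p)`, where `K` and `hat Z` are `h` and `Z` read in the chart.
  have key : ∀ Z : Π y : M, TangentSpace I y, MDiffAt (T% Z) x → ∀ v : TangentSpace I x,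
      mvfderiv I (fun y ↦ mvfderiv I h y (Z y)) x v =
        fderiv ℝ (fderiv ℝ K) (φ x) (mfderiv I 𝓘(ℝ, E) φ x v) (hat Z (φ x))
        + fderiv ℝ K (φ x) (fderiv ℝ (hat Z) (φ x) (mfderiv I 𝓘(ℝ, E) φ x v)) := by
    intro Z hZ v
    have e : (fun y ↦ mvfderiv I h y (Z y)) =ᶠ[nhds x]
        (fun p ↦ fderiv ℝ K p (hat Z p)) ∘ φ := by
      filter_upwards [hdh] with z hz
      rw [hz.2, Function.comp_apply, hat_apply Z z hz.1]
    rw [mvfderiv_congr e]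
    have h1 : HasMFDerivAt I 𝓘(ℝ, E) φ x (mfderiv I 𝓘(ℝ, E) φ x) :=
      (mdifferentiableAt_extChartAt (by simp)).hasMFDerivAt
    have hd2 : DifferentiableAt ℝ (fderiv ℝ K) (φ x) :=
      (hKs.fderiv_right (m := 1) (by norm_num)).differentiableAt (by simp)
    have h2 := hd2.hasFDerivAt.clm_apply (hat_diff Z hZ).hasFDerivAt
    have := (h2.hasMFDerivAt.comp x h1).mfderiv
    refine (congr($this v)).trans ?_
    exact add_comm _ _
  have hb : mfderiv I 𝓘(ℝ, E) φ x (mlieBracket I X Y x)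
      = fderiv ℝ (hat Y) (φ x) (hat X (φ x)) - fderiv ℝ (hat X) (φ x) (hat Y (φ x)) := by
    have h1 : lieBracketWithin ℝ (hat X) (hat Y) (Set.range I) (φ x)
        = fderiv ℝ (hat Y) (φ x) (hat X (φ x)) - fderiv ℝ (hat X) (φ x) (hat Y (φ x)) := by
      rw [lieBracketWithin, hr, fderivWithin_univ, fderivWithin_univ]
    rw [← h1, ← mlieBracketWithin_univ, mlieBracketWithin_apply, Set.preimage_univ, Set.univ_inter]
    exact (isInvertible_mfderiv_extChartAt (I := I)
      (mem_extChartAt_source (I := I) x)).self_apply_inverse _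
  have hs : IsSymmSndFDerivAt ℝ K (φ x) := hKs.isSymmSndFDerivAt (by simp)
  have hx := mem_extChartAt_source (I := I) x
  rw [hdh.self_of_nhds.2, hb, key Y hY, key X hX, ← hat_apply X x hx, ← hat_apply Y x hx,
    hs.eq (hat X (φ x)), map_sub]
  abel

end Bracket

/-! ### The metric in a trivialization, and smoothness tested by scalar products. -/

section MetricInCoordinates

variable {E : Type*} [NormedAddCommGroup E] [NormedSpace ℝ E] [FiniteDimensional ℝ E]
  {H : Type*} [TopologicalSpace H] {I : ModelWithCorners ℝ E H}
  {M : Type*} [TopologicalSpace M] [ChartedSpace H M] [IsManifold I ∞ M]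

lemma symm_trivializationAt_extend {p : M} (v : TangentSpace I p) (y : M) :
    (trivializationAt E (TangentSpace I : M → Type _) p).symm y
      (trivializationAt E (TangentSpace I : M → Type _) p ⟨p, v⟩).2 = FiberBundle.extend E v y :=
  rfl

/-- Every section with constant coordinates `a` is of the form `FiberBundle.extend`, so smoothness
of extensions applies to the coordinate frame. -/
lemma symm_trivializationAt_eq_extend (p : M) (a : E) (y : M) :
    (trivializationAt E (TangentSpace I : M → Type _) p).symm y a
      = FiberBundle.extend E
        ((trivializationAt E (TangentSpace I : M → Type _) p).symm p a) y := by
  rw [← symm_trivializationAt_extend, (trivializationAt E (TangentSpace I : M → Type _)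
    p).apply_mk_symm (FiberBundle.mem_baseSet_trivializationAt' p)]

/-- In the trivialization at `p`, an extended vector has constant coordinates. -/
lemma trivializationAt_extend_eventuallyEq {p : M} (v : TangentSpace I p) :
    (fun y ↦ (trivializationAt E (TangentSpace I : M → Type _) p
      ⟨y, FiberBundle.extend E v y⟩).2) =ᶠ[nhds p]
    fun _ ↦ (trivializationAt E (TangentSpace I : M → Type _) p ⟨p, v⟩).2 := by
  set e := trivializationAt E (TangentSpace I : M → Type _) p
  filter_upwards [e.open_baseSet.mem_nhds (FiberBundle.mem_baseSet_trivializationAt' p)] with z hz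
  exact congr($(e.apply_mk_symm hz (e ⟨p, v⟩).2).2)

namespace Metric

variable (g : Metric I M)

/-- The metric in the trivialization of the tangent bundle at `p`. -/
def coord (p y : M) : E →L[ℝ] E →L[ℝ] ℝ :=
  ContinuousLinearMap.precomp ℝ
      ((trivializationAt E (TangentSpace I : M → Type _) p).symmL ℝ y) ∘L g.inner y
    ∘L (trivializationAt E (TangentSpace I : M → Type _) p).symmL ℝ y

lemma coord_apply (p y : M) (a b : E) :
    g.coord p y a b = g.inner y
      ((trivializationAt E (TangentSpace I : M → Type _) p).symmL ℝ y a)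
      ((trivializationAt E (TangentSpace I : M → Type _) p).symmL ℝ y b) := rfl

lemma coord_apply_extend {p : M} (y : M) (v w : TangentSpace I p)
    (hy : y ∈ (trivializationAt E (TangentSpace I : M → Type _) p).baseSet) :
    g.coord p y (trivializationAt E (TangentSpace I : M → Type _) p ⟨p, v⟩).2
      (trivializationAt E (TangentSpace I : M → Type _) p ⟨p, w⟩).2
      = g.inner y (FiberBundle.extend E v y) (FiberBundle.extend E w y) := by
  rw [coord_apply, Trivialization.symmL_apply _ hy, Trivialization.symmL_apply _ hy]
  rfl

lemma coord_apply_trivializationAt {p y : M} (v w : TangentSpace I y)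
    (hy : y ∈ (trivializationAt E (TangentSpace I : M → Type _) p).baseSet) :
    g.coord p y (trivializationAt E (TangentSpace I : M → Type _) p ⟨y, v⟩).2
      (trivializationAt E (TangentSpace I : M → Type _) p ⟨y, w⟩).2
      = g.inner y v w := by
  rw [coord_apply, Trivialization.symmL_apply _ hy, Trivialization.symmL_apply _ hy,
    Trivialization.symm_apply_apply_mk _ hy, Trivialization.symm_apply_apply_mk _ hy]

/-- Fields along a map cover both fields on `M` (the map being the identity) and ambient fields
restricted to an immersion. -/
lemma contMDiffAt_inner {E₁ : Type*} [NormedAddCommGroup E₁] [NormedSpace ℝ E₁]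
    {H₁ : Type*} [TopologicalSpace H₁] {J : ModelWithCorners ℝ E₁ H₁}
    {S : Type*} [TopologicalSpace S] [ChartedSpace H₁ S] {f : S → M} {x : S}
    {V W : Π z : S, TangentSpace I (f z)} (hf : ContMDiffAt J I ∞ f x)
    (hV : ContMDiffAt J I.tangent ∞ (fun z ↦ (⟨f z, V z⟩ : TangentBundle I M)) x)
    (hW : ContMDiffAt J I.tangent ∞ (fun z ↦ (⟨f z, W z⟩ : TangentBundle I M)) x) :
    ContMDiffAt J 𝓘(ℝ) ∞ (fun z ↦ g.inner (f z) (V z) (W z)) x := by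
  have : ContMDiffAt J (I.prod 𝓘(ℝ)) ∞
      (fun z ↦ TotalSpace.mk' ℝ (E := Bundle.Trivial M ℝ) (f z)
        (g.inner (f z) (V z) (W z))) x := by
    apply ContMDiffAt.clm_bundle_apply₂ (F₁ := E) (F₂ := E)
    · exact (g.contMDiff (f x)).comp x hf
    · exact hV
    · exact hW
  rw [contMDiffAt_totalSpace] at this
  exact this.2

lemma contMDiffAt_coord (p : M) : ContMDiffAt I 𝓘(ℝ, E →L[ℝ] E →L[ℝ] ℝ) ∞ (g.coord p) p := by
  set e := trivializationAt E (TangentSpace I : M → Type _) p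
  have hp : p ∈ e.baseSet := FiberBundle.mem_baseSet_trivializationAt' p
  refine contMDiffAt_clm_of_apply fun a ↦ contMDiffAt_clm_of_apply fun b ↦ ?_
  have h := g.contMDiffAt_inner (contMDiffAt_id (x := p))
    (FiberBundle.contMDiffAt_extend (k := ∞) I E (e.symm p a))
    (FiberBundle.contMDiffAt_extend (k := ∞) I E (e.symm p b))
  refine h.congr_of_eventuallyEq ?_
  filter_upwards [e.open_baseSet.mem_nhds hp] with y hy
  rw [coord_apply, Trivialization.symmL_apply _ hy, Trivialization.symmL_apply _ hy]
  exact congr(g.inner y $(symm_trivializationAt_eq_extend p a y)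
    $(symm_trivializationAt_eq_extend p b y))

/-- Nondegeneracy gives injectivity, and a space and its dual have equal dimension. Invertibility
lets the coordinates of a field be recovered from its scalar products. -/
lemma isInvertible_coord {p y : M}
    (hy : y ∈ (trivializationAt E (TangentSpace I : M → Type _) p).baseSet) :
    (g.coord p y).IsInvertible := by
  set e := trivializationAt E (TangentSpace I : M → Type _) p
  have hinj : Function.Injective (g.coord p y : E →ₗ[ℝ] (E →L[ℝ] ℝ)) := by
    refine (injective_iff_map_eq_zero _).2 fun a ha ↦ ?_
    have h0 : e.symmL ℝ y a = 0 := by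
      refine g.nondegenerate y _ fun w ↦ ?_
      have := congr($ha (e ⟨y, w⟩).2)
      have h2 := g.coord_apply p y a (e ⟨y, w⟩).2
      rw [Trivialization.symmL_apply (R := ℝ) (e := e) hy (e ⟨y, w⟩).2,
        Trivialization.symm_apply_apply_mk _ hy] at h2
      exact h2.symm.trans this
    have h1 := e.continuousLinearMapAt_symmL (R := ℝ) hy a
    rw [← h1, h0, map_zero]
  have hdim : Module.finrank ℝ E = Module.finrank ℝ (E →L[ℝ] ℝ) :=
    (Subspace.dual_finrank_eq (K := ℝ) (V := E)).symm.trans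
      (LinearMap.toContinuousLinearMap (𝕜 := ℝ) (E := E) (F' := ℝ)).finrank_eq
  exact ⟨(LinearMap.linearEquivOfInjective _ hinj hdim).toContinuousLinearEquiv, by ext; rfl⟩

/-- A vector field is smooth if its scalar products with smooth vector fields are. -/
lemma contMDiffAt_of_inner {V : Π y : M, TangentSpace I y} {p : M}
    (h : ∀ v : TangentSpace I p, ContMDiffAt I 𝓘(ℝ) ∞
      (fun y ↦ g.inner y (V y) (FiberBundle.extend E v y)) p) :
    CMDiffAt ∞ (T% V) p := by
  set e := trivializationAt E (TangentSpace I : M → Type _) p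
  have hp : p ∈ e.baseSet := FiberBundle.mem_baseSet_trivializationAt' p
  rw [contMDiffAt_section]
  have hφ : ContMDiffAt I 𝓘(ℝ, E →L[ℝ] ℝ) ∞
      (fun y ↦ ((g.inner y (V y)).comp (e.symmL ℝ y) : E →L[ℝ] ℝ)) p := by
    refine contMDiffAt_clm_of_apply fun a ↦ (h (e.symm p a)).congr_of_eventuallyEq ?_
    filter_upwards [e.open_baseSet.mem_nhds hp] with y hy
    exact congr(g.inner y (V y)
      $((Trivialization.symmL_apply e hy a).trans (symm_trivializationAt_eq_extend p a y)))
  -- The coordinates of `V` are the inverse of the Gram operator applied to the covector `⟨V, ·⟩`,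
  -- and inversion is smooth at invertible operators.
  have hinv : ContMDiffAt I 𝓘(ℝ, (E →L[ℝ] ℝ) →L[ℝ] E) ∞ (fun y ↦ (g.coord p y).inverse) p :=
    (g.isInvertible_coord hp).contDiffAt_map_inverse.contMDiffAt.comp p (g.contMDiffAt_coord p)
  refine (hinv.clm_apply hφ).congr_of_eventuallyEq ?_
  filter_upwards [e.open_baseSet.mem_nhds hp] with y hy
  refine ((g.isInvertible_coord hy).inverse_apply_eq.2 ?_).symm
  ext a
  have h2 := g.coord_apply p y (e ⟨y, V y⟩).2 a
  rw [Trivialization.symmL_apply (R := ℝ) (e := e) hy (e ⟨y, V y⟩).2,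
        Trivialization.symm_apply_apply_mk _ hy] at h2
  exact h2.symm

end Metric

end MetricInCoordinates

/-! ### Coordinate vector fields. -/

section CoordinateFields

variable {E : Type*} [NormedAddCommGroup E] [NormedSpace ℝ E] [FiniteDimensional ℝ E]
  {H : Type*} [TopologicalSpace H] {I : ModelWithCorners ℝ E H}
  {M : Type*} [TopologicalSpace M] [ChartedSpace H M] [IsManifold I ∞ M]

/-- The trivialization of the tangent bundle at `p` is the differential of the chart at `p`. -/
lemma trivializationAt_snd_eq_mfderiv_extChartAt {p y : M} (hy : y ∈ (chartAt H p).source)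
    (v : TangentSpace I y) :
    (trivializationAt E (TangentSpace I : M → Type _) p ⟨y, v⟩).2
      = mvfderiv I (extChartAt I p) y v := by
  have h1 := TangentBundle.continuousLinearMapAt_trivializationAt (I := I) hy
  have h2 := congr($(Trivialization.coe_linearMapAt_of_mem (R := ℝ)
    (trivializationAt E (TangentSpace I : M → Type _) p) (b := y) (by simpa using hy)) v)
  exact h2.symm.trans congr($h1 v)

/-- Coordinate vector fields commute. -/
lemma mlieBracket_extend [I.Boundaryless] {p : M} (v w : TangentSpace I p) :
    mlieBracket I (FiberBundle.extend E v) (FiberBundle.extend E w) p = 0 := by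
  set e := trivializationAt E (TangentSpace I : M → Type _) p
  have hp : p ∈ e.baseSet := FiberBundle.mem_baseSet_trivializationAt' p
  -- The differential of the chart sends an extended vector to a constant, so both iterated
  -- derivatives of the chart vanish, and with them the chart components of the bracket.
  have hc : ∀ u : TangentSpace I p,
      mvfderiv I (fun y ↦ mvfderiv I (extChartAt I p) y (FiberBundle.extend E u y)) p = 0 := by
    intro u
    have : (fun y ↦ mvfderiv I (extChartAt I p) y (FiberBundle.extend E u y))
        =ᶠ[nhds p] fun _ ↦ (e ⟨p, u⟩).2 := by
      filter_upwards [trivializationAt_extend_eventuallyEq u, (chartAt H p).open_source.mem_nhds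
        (mem_chart_source H p)] with y hy hy'
      rw [← trivializationAt_snd_eq_mfderiv_extChartAt hy', hy]
    rw [mvfderiv_congr this, mvfderiv_const]
  have h := mvfderiv_mlieBracket (contMDiffAt_extChartAt (n := 2) (x := p))
    (FiberBundle.mdifferentiableAt_extend I E v) (FiberBundle.mdifferentiableAt_extend I E w)
  rw [hc, hc, ← trivializationAt_snd_eq_mfderiv_extChartAt (mem_chart_source H p)] at h
  have h1 := e.symm_apply_apply_mk hp
    (mlieBracket I (FiberBundle.extend E v) (FiberBundle.extend E w) p)
  rw [← h1, h]
  simp [← Trivialization.symmL_apply (R := ℝ) e hp]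

end CoordinateFields

/-! ### The covariant derivative along a map: compatibility with the metric and torsion. -/

section Immersion

variable {E : Type*} [NormedAddCommGroup E] [NormedSpace ℝ E] [FiniteDimensional ℝ E]
  {H : Type*} [TopologicalSpace H] {I : ModelWithCorners ℝ E H}
  {M : Type*} [TopologicalSpace M] [ChartedSpace H M] [IsManifold I ∞ M]
  {E' : Type*} [NormedAddCommGroup E'] [NormedSpace ℝ E'] [FiniteDimensional ℝ E']
  {H' : Type*} [TopologicalSpace H'] {I' : ModelWithCorners ℝ E' H'}
  {M' : Type*} [TopologicalSpace M'] [ChartedSpace H' M'] [IsManifold I' ∞ M']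
  {g : Metric I M} {g' : Metric I' M'} {f : M → M'}

lemma covAlong_apply (cov : CovariantDerivative I' E' (TangentSpace I' : M' → Type _))
    (W : Π z : M, TangentSpace I' (f z)) (x : M) (u : TangentSpace I x) :
    covAlong I cov f W x u
      = (trivializationAt E' (TangentSpace I' : M' → Type _) (f x)).symmL ℝ (f x)
          (mvfderiv I (fun z ↦ (trivializationAt E' (TangentSpace I' : M' → Type _) (f x)
            ⟨f z, W z⟩).2) x u)
        + cov (FiberBundle.extend E' (W x)) (f x) (mfderiv I I' f x u) := rfl

/-- The covariant derivative along `f` is compatible with the metric. -/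
lemma mvfderiv_inner_covAlong {V W : Π z : M, TangentSpace I' (f z)} {x : M}
    (hf : MDifferentiableAt I I' f x)
    (hV : MDifferentiableAt I I'.tangent (fun z ↦ (⟨f z, V z⟩ : TangentBundle I' M')) x)
    (hW : MDifferentiableAt I I'.tangent (fun z ↦ (⟨f z, W z⟩ : TangentBundle I' M')) x)
    (u : TangentSpace I x) :
    mvfderiv I (fun z ↦ g'.inner (f z) (V z) (W z)) x u
      = g'.inner (f x) (covAlong I g'.leviCivita f V x u) (W x)
        + g'.inner (f x) (V x) (covAlong I g'.leviCivita f W x u) := by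
  set e := trivializationAt E' (TangentSpace I' : M' → Type _) (f x) with he
  have hfx : f x ∈ e.baseSet := FiberBundle.mem_baseSet_trivializationAt' (f x)
  have hv : MDifferentiableAt I 𝓘(ℝ, E') (fun z ↦ (e ⟨f z, V z⟩).2) x :=
    ((mdifferentiableAt_totalSpace ..).1 hV).2
  have hw : MDifferentiableAt I 𝓘(ℝ, E') (fun z ↦ (e ⟨f z, W z⟩).2) x :=
    ((mdifferentiableAt_totalSpace ..).1 hW).2
  have hG : MDifferentiableAt I' 𝓘(ℝ, E' →L[ℝ] E' →L[ℝ] ℝ) (g'.coord (f x)) (f x) :=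
    (g'.contMDiffAt_coord (f x)).mdifferentiableAt (by simp)
  have hGf : MDifferentiableAt I 𝓘(ℝ, E' →L[ℝ] E' →L[ℝ] ℝ) (fun z ↦ g'.coord (f x) (f z)) x :=
    hG.comp x hf
  have hloc : (fun z ↦ g'.inner (f z) (V z) (W z)) =ᶠ[nhds x]
      fun z ↦ g'.coord (f x) (f z) (e ⟨f z, V z⟩).2 (e ⟨f z, W z⟩).2 := by
    filter_upwards [hf.continuousAt.preimage_mem_nhds (e.open_baseSet.mem_nhds hfx)] with z hz
    exact (g'.coord_apply_trivializationAt _ _ hz).symm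
  -- The derivative of the metric coefficients, with frozen components, is metric compatibility of
  -- `g'.leviCivita` for the constant-coordinate extensions of `V x` and `W x`. The derivatives of
  -- the components supply the other terms.
  have hcoord : mvfderiv I (fun z ↦ g'.coord (f x) (f z)) x u (e ⟨f x, V x⟩).2 (e ⟨f x, W x⟩).2
      = g'.inner (f x) (g'.leviCivita (FiberBundle.extend E' (V x)) (f x) (mfderiv I I' f x u))
          (W x)
        + g'.inner (f x) (V x)
          (g'.leviCivita (FiberBundle.extend E' (W x)) (f x) (mfderiv I I' f x u)) := by
    have h1 : mvfderiv I (fun z ↦ g'.coord (f x) (f z)) x u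
        = mvfderiv I' (g'.coord (f x)) (f x) (mfderiv I I' f x u) :=
      mfderiv_comp_apply x hG hf u
    have h2 : ∀ a b : E', mvfderiv I' (g'.coord (f x)) (f x) (mfderiv I I' f x u) a b
        = mvfderiv I' (fun y ↦ g'.coord (f x) y a b) (f x) (mfderiv I I' f x u) := by
      intro a b
      have hc : ∀ c : E', MDifferentiableAt I' 𝓘(ℝ, E') (fun _ : M' ↦ c) (f x) :=
        fun c ↦ mdifferentiableAt_const
      rw [mvfderiv_clm_apply (hG.clm_apply (hc a)) (hc b), mvfderiv_clm_apply hG (hc a),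
        mvfderiv_const, mvfderiv_const]
      simp
    have h3 : (fun y ↦ g'.coord (f x) y (e ⟨f x, V x⟩).2 (e ⟨f x, W x⟩).2) =ᶠ[nhds (f x)]
        fun y ↦ g'.inner y (FiberBundle.extend E' (V x) y) (FiberBundle.extend E' (W x) y) := by
      filter_upwards [e.open_baseSet.mem_nhds hfx] with y hy
      exact g'.coord_apply_extend y _ _ hy
    have h4 := g'.mvfderiv_inner_leviCivita
      (FiberBundle.mdifferentiableAt_extend I' E' (mfderiv I I' f x u))
      (FiberBundle.mdifferentiableAt_extend I' E' (V x))
      (FiberBundle.mdifferentiableAt_extend I' E' (W x))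
    simp only [FiberBundle.extend_apply_self] at h4
    rw [h1, h2, mvfderiv_congr h3, h4]
  have hs : ∀ w : TangentSpace I' (f x), e.symmL ℝ (f x) (e ⟨f x, w⟩).2 = w := fun w ↦
    (e.symmL_apply hfx _).trans (e.symm_apply_apply_mk hfx w)
  rw [mvfderiv_congr hloc, mvfderiv_clm_apply (hGf.clm_apply hv) hw, mvfderiv_clm_apply hGf hv,
    add_apply, hcoord, covAlong_apply, covAlong_apply, Metric.coord_apply, Metric.coord_apply, hs,
    hs, map_add, map_add, add_apply]
  ring

lemma contMDiffAt_mfderiv_apply (hf : ContMDiff I I' ∞ f) {Y : Π y : M, TangentSpace I y} {x : M}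
    (hY : CMDiffAt ∞ (T% Y) x) :
    ContMDiffAt I I'.tangent ∞
      (fun z ↦ (⟨f z, mfderiv I I' f z (Y z)⟩ : TangentBundle I' M')) x :=
  (hf.contMDiff_tangentMap (m := ∞) (by simp)).contMDiffAt.comp x hY

lemma mdifferentiableAt_mfderiv_apply (hf : ContMDiff I I' ∞ f) {Y : Π y : M, TangentSpace I y}
    {x : M} (hY : MDiffAt (T% Y) x) :
    MDifferentiableAt I I'.tangent
      (fun z ↦ (⟨f z, mfderiv I I' f z (Y z)⟩ : TangentBundle I' M')) x :=
  ((hf.contMDiff_tangentMap (m := ∞) (by simp)).mdifferentiable (by simp) _).comp x hY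

/-- The covariant derivative along `f` is torsion-free. -/
lemma covAlong_mfderiv_sub [I.Boundaryless] [I'.Boundaryless] (hf : ContMDiff I I' ∞ f)
    {X Y : Π y : M, TangentSpace I y} {x : M} (hX : MDiffAt (T% X) x) (hY : MDiffAt (T% Y) x) :
    covAlong I g'.leviCivita f (fun z ↦ mfderiv I I' f z (Y z)) x (X x)
      - covAlong I g'.leviCivita f (fun z ↦ mfderiv I I' f z (X z)) x (Y x)
      = mfderiv I I' f x (mlieBracket I X Y x) := by
  set e := trivializationAt E' (TangentSpace I' : M' → Type _) (f x) with he
  have hfx : f x ∈ e.baseSet := FiberBundle.mem_baseSet_trivializationAt' (f x)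
  let h : M → E' := extChartAt I' (f x) ∘ f
  have hh : ContMDiffAt I 𝓘(ℝ, E') 2 h x :=
    contMDiffAt_extChartAt.comp x (hf.contMDiffAt.of_le
      (WithTop.coe_le_coe.2 (le_top : (2 : ℕ∞) ≤ ⊤)))
  -- The components of `df(Z)` are the derivatives of `h`, the map `f` read in the target chart. A
  -- whole neighbourhood is needed, as these components are differentiated again.
  have hdh : ∀ᶠ z in nhds x, ∀ v : TangentSpace I z,
      (e ⟨f z, mfderiv I I' f z v⟩).2 = mvfderiv I h z v := by
    filter_upwards [hf.continuous.continuousAt.preimage_mem_nhds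
      ((chartAt H' (f x)).open_source.mem_nhds (mem_chart_source H' (f x)))] with z hz v
    rw [he, trivializationAt_snd_eq_mfderiv_extChartAt hz]
    exact (mfderiv_comp_apply z (mdifferentiableAt_extChartAt hz)
      (hf.mdifferentiable (by simp) z) v).symm
  have hd : ∀ Z : Π y : M, TangentSpace I y,
      mvfderiv I (fun z ↦ (e ⟨f z, mfderiv I I' f z (Z z)⟩).2) x
        = mvfderiv I (fun z ↦ mvfderiv I h z (Z z)) x := fun Z ↦
    mvfderiv_congr (hdh.mono fun z hz ↦ hz (Z z))
  -- The connection terms of the two derivatives cancel: their difference is the bracket of two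
  -- coordinate fields.
  have ht := g'.torsion_leviCivita
    (FiberBundle.mdifferentiableAt_extend I' E' (mfderiv I I' f x (X x)))
    (FiberBundle.mdifferentiableAt_extend I' E' (mfderiv I I' f x (Y x)))
  simp only [FiberBundle.extend_apply_self, mlieBracket_extend] at ht
  have hb : e.symmL ℝ (f x) (mvfderiv I h x (mlieBracket I X Y x))
      = mfderiv I I' f x (mlieBracket I X Y x) := by
    rw [← hdh.self_of_nhds]
    exact (e.symmL_apply hfx _).trans (e.symm_apply_apply_mk hfx _)
  rw [covAlong_apply, covAlong_apply, hd, hd, add_sub_add_comm, ht, add_zero, ← map_sub,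
    ← mvfderiv_mlieBracket hh hX hY, hb]

end Immersion

/-! ### Weingarten operator, tangential part and Lie derivative on a hypersurface. -/

section Hypersurface

variable {E : Type*} [NormedAddCommGroup E] [NormedSpace ℝ E] [FiniteDimensional ℝ E]
  {H : Type*} [TopologicalSpace H] {I : ModelWithCorners ℝ E H}
  {M : Type*} [TopologicalSpace M] [ChartedSpace H M] [IsManifold I ∞ M]
  {E' : Type*} [NormedAddCommGroup E'] [NormedSpace ℝ E'] [FiniteDimensional ℝ E']
  {H' : Type*} [TopologicalSpace H'] {I' : ModelWithCorners ℝ E' H'}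
  {M' : Type*} [TopologicalSpace M'] [ChartedSpace H' M'] [IsManifold I' ∞ M']
  {g : Metric I M} {g' : Metric I' M'} {f : M → M'}

/-- `(L_X g)(Y, Z) = ⟨∇_Y X, Z⟩ + ⟨Y, ∇_Z X⟩`. -/
lemma Metric.lieDeriv_eq_leviCivita {X : Π y : M, TangentSpace I y} {x : M}
    (hX : MDiffAt (T% X) x) (u v : TangentSpace I x) :
    g.lieDeriv X x u v = g.inner x (g.leviCivita X x u) v + g.inner x u (g.leviCivita X x v) := by
  have hU := FiberBundle.mdifferentiableAt_extend I E u
  have hV := FiberBundle.mdifferentiableAt_extend I E v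
  have h := g.lieDeriv_apply X hU hV
  rw [g.mvfderiv_inner_leviCivita hX hU hV, ← g.torsion_leviCivita hX hU,
    ← g.torsion_leviCivita hX hV] at h
  simp only [FiberBundle.extend_apply_self, map_sub, sub_apply] at h
  rw [h]
  ring

/-- The Lie derivative of the induced metric, through the ambient connection. -/
lemma IsIsometricImmersion.lieDeriv_eq_covAlong [I.Boundaryless] [I'.Boundaryless]
    (hf : IsIsometricImmersion g g' f) {X : Π y : M, TangentSpace I y} {x : M}
    (hX : MDiffAt (T% X) x) (u v : TangentSpace I x) :
    g.lieDeriv X x u v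
      = g'.inner (f x)
          (covAlong I g'.leviCivita f (fun z ↦ mfderiv I I' f z (X z)) x u) (mfderiv I I' f x v)
        + g'.inner (f x) (mfderiv I I' f x u)
          (covAlong I g'.leviCivita f (fun z ↦ mfderiv I I' f z (X z)) x v) := by
  have hU := FiberBundle.mdifferentiableAt_extend I E u
  have hV := FiberBundle.mdifferentiableAt_extend I E v
  have h := g.lieDeriv_apply X hU hV
  -- Reading `g` as the pullback of `g'` puts the ambient derivative along `f` in place of the
  -- Levi-Civita connection of `g`; by zero torsion the terms in `∇_X df(U)` and `∇_X df(V)` then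
  -- cancel.
  simp only [← hf.inner_mfderiv] at h
  rw [mvfderiv_inner_covAlong (hf.contMDiff.mdifferentiable (by simp) x)
    (mdifferentiableAt_mfderiv_apply hf.contMDiff hU)
    (mdifferentiableAt_mfderiv_apply hf.contMDiff hV),
    ← covAlong_mfderiv_sub (g' := g') hf.contMDiff hX hU,
    ← covAlong_mfderiv_sub (g' := g') hf.contMDiff hX hV] at h
  simp only [FiberBundle.extend_apply_self, map_sub, sub_apply] at h
  rw [h]
  ring

lemma inner_weingarten (N : Π x : M, TangentSpace I' (f x)) (x : M) (u v : TangentSpace I x) :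
    g.inner x (weingarten g g' f N x u) v
      = -g'.inner (f x) (covAlong I g'.leviCivita f N x u) (mfderiv I I' f x v) := by
  simp [weingarten]

/-- The second fundamental form, through the derivative of a tangent field. -/
lemma IsUnitNormal.inner_covAlong_mfderiv {N : Π x : M, TangentSpace I' (f x)}
    (hf : ContMDiff I I' ∞ f) (hN : IsUnitNormal (I := I) g' f N) {Y : Π y : M, TangentSpace I y}
    {x : M} (hY : MDiffAt (T% Y) x) (u : TangentSpace I x) :
    g'.inner (f x) (N x) (covAlong I g'.leviCivita f (fun z ↦ mfderiv I I' f z (Y z)) x u)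
      = g.inner x (weingarten g g' f N x u) (Y x) := by
  -- Differentiate the identity `⟨N, df(Y)⟩ = 0`.
  have h := mvfderiv_inner_covAlong (g' := g') (hf.mdifferentiable (by simp) x)
    (hN.contMDiff.mdifferentiable (by simp) x) (mdifferentiableAt_mfderiv_apply hf hY) u
  simp only [hN.inner_mfderiv, mvfderiv_const, zero_apply] at h
  rw [inner_weingarten]
  linarith

/-- The Weingarten operator is self-adjoint. -/
lemma IsUnitNormal.inner_weingarten_comm [I.Boundaryless] [I'.Boundaryless]
    {N : Π x : M, TangentSpace I' (f x)} (hf : ContMDiff I I' ∞ f)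
    (hN : IsUnitNormal (I := I) g' f N) (x : M) (u v : TangentSpace I x) :
    g.inner x (weingarten g g' f N x u) v = g.inner x (weingarten g g' f N x v) u := by
  have hU := FiberBundle.mdifferentiableAt_extend I E u
  have hV := FiberBundle.mdifferentiableAt_extend I E v
  -- By zero torsion the antisymmetric part is `⟨N, df[U, V]⟩`, which vanishes since `N` is normal.
  have h := congr(g'.inner (f x) (N x) $(covAlong_mfderiv_sub (g' := g') hf hU hV))
  rw [map_sub, hN.inner_mfderiv, hN.inner_covAlong_mfderiv (g := g) hf hV,
    hN.inner_covAlong_mfderiv (g := g) hf hU] at h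
  simp only [FiberBundle.extend_apply_self] at h
  linarith

lemma IsUnitNormal.inner_self_mul_inner_self {N : Π x : M, TangentSpace I' (f x)}
    (hN : IsUnitNormal (I := I) g' f N) (x : M) :
    g'.inner (f x) (N x) (N x) * g'.inner (f x) (N x) (N x) = 1 := by
  rcases hN.inner_self x with h | h <;> simp [h]

/-- Along a hypersurface, a vector is the sum of its tangential and normal parts. -/
lemma mfderiv_tangentialPart_add {N : Π x : M, TangentSpace I' (f x)}
    (hf : IsIsometricImmersion g g' f) (hN : IsUnitNormal (I := I) g' f N)
    (hdim : Module.finrank ℝ E' = Module.finrank ℝ E + 1) (x : M) (w : TangentSpace I' (f x)) :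
    mfderiv I I' f x (tangentialPart g g' f x w)
      + (g'.inner (f x) (N x) (N x) * g'.inner (f x) w (N x)) • N x = w := by
  -- `L` is injective because `N` is normal and not null, hence bijective by `hdim`. It thus
  -- suffices to test the decomposition against vectors `df(u) + t N`, where `ε * ε = 1` settles the
  -- normal component.
  let L : TangentSpace I x × ℝ →ₗ[ℝ] TangentSpace I' (f x) :=
    (mfderiv I I' f x : TangentSpace I x →ₗ[ℝ] TangentSpace I' (f x)).coprod
      (LinearMap.toSpanSingleton ℝ _ (N x))
  have hL : ∀ u t, L (u, t) = mfderiv I I' f x u + t • N x := fun u t ↦ rfl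
  have hε := hN.inner_self_mul_inner_self x
  have hinj : Function.Injective L := by
    refine (injective_iff_map_eq_zero L).2 ?_
    rintro ⟨u, t⟩ h
    rw [hL] at h
    have h1 := congr(g'.inner (f x) (N x) $h)
    rw [map_add, hN.inner_mfderiv, map_smul, map_zero, zero_add, smul_eq_mul] at h1
    have ht : t = 0 := by
      calc t = t * g'.inner (f x) (N x) (N x) * g'.inner (f x) (N x) (N x) := by
            rw [mul_assoc, hε, mul_one]
        _ = 0 := by rw [h1, zero_mul]
    rw [ht, zero_smul, add_zero] at h
    have hu : u = 0 := hf.injective_mfderiv x (h.trans (map_zero _).symm)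
    rw [ht, hu]
    rfl
  have hsurj : Function.Surjective L := by
    refine (LinearMap.injective_iff_surjective_of_finrank_eq_finrank ?_).1 hinj
    have h1 : Module.finrank ℝ (TangentSpace I x) = Module.finrank ℝ E := rfl
    have h2 : Module.finrank ℝ (TangentSpace I' (f x)) = Module.finrank ℝ E' := rfl
    rw [Module.finrank_prod, Module.finrank_self, h1, h2, hdim]
  refine g'.ext_inner fun z ↦ ?_
  obtain ⟨⟨u, t⟩, rfl⟩ := hsurj z
  have h1 : g'.inner (f x) (mfderiv I I' f x (tangentialPart g g' f x w)) (N x) = 0 := by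
    rw [g'.symm, hN.inner_mfderiv]
  rw [hL]
  simp only [map_add, add_apply, map_smul, smul_apply, smul_eq_mul, hf.inner_mfderiv,
    inner_tangentialPart, hN.inner_mfderiv, h1]
  linear_combination t * g'.inner (f x) w (N x) * hε

/-- The tangential part of a smooth ambient field is smooth. -/
lemma IsIsometricImmersion.contMDiff_tangentialPart (hf : IsIsometricImmersion g g' f)
    {X : Π y : M', TangentSpace I' y} (hX : CMDiff ∞ (T% X)) :
    CMDiff ∞ (T% (fun x ↦ tangentialPart g g' f x (X (f x)))) := fun x ↦ by
  refine g.contMDiffAt_of_inner fun v ↦ ?_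
  simp only [inner_tangentialPart]
  exact g'.contMDiffAt_inner hf.contMDiff.contMDiffAt
    ((hX.comp hf.contMDiff).contMDiffAt)
    (contMDiffAt_mfderiv_apply hf.contMDiff (FiberBundle.contMDiffAt_extend I E v))

/-- For a field `X` on the ambient manifold with tangential part `V` and angle function `C`,
`⟨∇_u X, v⟩ = ⟨∇_u V, v⟩ - ε C ⟨A u, v⟩`. -/
lemma inner_leviCivita_mfderiv {N : Π x : M, TangentSpace I' (f x)}
    (hf : IsIsometricImmersion g g' f) (hN : IsUnitNormal (I := I) g' f N)
    (hdim : Module.finrank ℝ E' = Module.finrank ℝ E + 1)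
    {X : Π y : M', TangentSpace I' y} (hX : CMDiff ∞ (T% X)) (x : M) (u v : TangentSpace I x) :
    g'.inner (f x) (g'.leviCivita X (f x) (mfderiv I I' f x u)) (mfderiv I I' f x v)
      = g'.inner (f x) (covAlong I g'.leviCivita f
          (fun z ↦ mfderiv I I' f z (tangentialPart g g' f z (X (f z)))) x u) (mfderiv I I' f x v)
        - g'.inner (f x) (N x) (N x) * angleFunction g' f N X x
          * g.inner x (weingarten g g' f N x u) v := by
  have hfx : MDifferentiableAt I I' f x := hf.contMDiff.mdifferentiable (by simp) x
  have hV := FiberBundle.mdifferentiableAt_extend I E v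
  have hdV := mdifferentiableAt_mfderiv_apply hf.contMDiff hV
  have hXf : MDifferentiableAt I I'.tangent (fun z ↦ (⟨f z, X (f z)⟩ : TangentBundle I' M')) x :=
    (hX.comp hf.contMDiff).mdifferentiable (by simp) x
  have hT := mdifferentiableAt_mfderiv_apply hf.contMDiff
    ((hf.contMDiff_tangentialPart hX).mdifferentiable (by simp) x)
  -- The functions `⟨X, df v⟩` and `⟨df(V), df v⟩` coincide. Comparing their derivatives leaves `⟨X
  -- - df(V), ∇_u df v⟩ = ε C ⟨N, ∇_u df v⟩ = ε C ⟨A u, v⟩`, so neither `C` nor the product `C N`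
  -- has to be differentiated.
  have h1 := mvfderiv_inner_covAlong (g' := g') hfx hXf hdV u
  have h2 := mvfderiv_inner_covAlong (g' := g') hfx hT hdV u
  have h3 := hN.inner_covAlong_mfderiv (g := g) hf.contMDiff hV u
  simp only [hf.inner_mfderiv, inner_tangentialPart] at h2
  rw [h1, covAlong_comp _ hfx (hX.mdifferentiable (by simp) (f x))] at h2
  have h4 := congr(g'.inner (f x) $(mfderiv_tangentialPart_add hf hN hdim x (X (f x)))
    (covAlong I g'.leviCivita f
      (fun z ↦ mfderiv I I' f z (FiberBundle.extend E v z)) x u))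
  simp only [map_add, add_apply, map_smul, smul_apply, smul_eq_mul, h3] at h4
  simp only [FiberBundle.extend_apply_self, ContinuousLinearMap.comp_apply] at h2 h4
  rw [angleFunction]
  linarith

/-- The Lie derivative of the induced metric of a hypersurface along the tangential part of a
conformal field. -/
lemma IsConformalField.half_lieDeriv_tangentialPart [I.Boundaryless] [I'.Boundaryless]
    {N : Π x : M, TangentSpace I' (f x)} (hf : IsIsometricImmersion g g' f)
    (hN : IsUnitNormal (I := I) g' f N) (hdim : Module.finrank ℝ E' = Module.finrank ℝ E + 1)
    {X : Π y : M', TangentSpace I' y} {σ : M' → ℝ} (hX : IsConformalField g' X σ)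
    (x : M) (u v : TangentSpace I x) :
    1 / 2 * g.lieDeriv (fun x ↦ tangentialPart g g' f x (X (f x))) x u v
      = σ (f x) * g.inner x u v + g'.inner (f x) (N x) (N x) * angleFunction g' f N X x
        * g.inner x (weingarten g g' f N x u) v := by
  have h1 := hX.lieDeriv_eq (f x) (mfderiv I I' f x u) (mfderiv I I' f x v)
  rw [Metric.lieDeriv_eq_leviCivita (hX.contMDiff_field.mdifferentiable (by simp) (f x)),
    g'.symm (f x) (mfderiv I I' f x u) (g'.leviCivita X (f x) (mfderiv I I' f x v)),
    inner_leviCivita_mfderiv hf hN hdim hX.contMDiff_field,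
    inner_leviCivita_mfderiv hf hN hdim hX.contMDiff_field, hf.inner_mfderiv,
    hN.inner_weingarten_comm hf.contMDiff x v u] at h1
  rw [hf.lieDeriv_eq_covAlong
    ((hf.contMDiff_tangentialPart hX.contMDiff_field).mdifferentiable (by simp) x),
    g'.symm (f x) (mfderiv I I' f x u)]
  linarith

end Hypersurface

end SemiRiemannian

end

theorem lemma2 {n : ℕ}
    {M : Type*} [TopologicalSpace M] [ChartedSpace (EuclideanSpace ℝ (Fin n)) M]
    [IsManifold (𝓡 n) ∞ M]
    {M' : Type*} [TopologicalSpace M'] [ChartedSpace (EuclideanSpace ℝ (Fin (n + 1))) M']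
    [IsManifold (𝓡 (n + 1)) ∞ M']
    (g : ContMDiffRiemannianMetric (𝓡 n) ∞ (EuclideanSpace ℝ (Fin n))
      (TangentSpace (𝓡 n) : M → Type _))
    (g' : SemiRiemannian.Metric (𝓡 (n + 1)) M')
    (f : M → M')
    (hf : SemiRiemannian.IsIsometricImmersion (SemiRiemannian.Metric.ofRiemannian g) g' f)
    (N : (x : M) → TangentSpace (𝓡 (n + 1)) (f x))
    (hN : SemiRiemannian.IsUnitNormal (I := 𝓡 n) g' f N)
    (Vbar : (y : M') → TangentSpace (𝓡 (n + 1)) y) (σ : M' → ℝ)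
    (hV : SemiRiemannian.IsConformalField g' Vbar σ)
    (lam : M → ℝ) :
    SemiRiemannian.IsRicciAlmostSoliton (SemiRiemannian.Metric.ofRiemannian g)
        (fun x ↦ SemiRiemannian.tangentialPart (SemiRiemannian.Metric.ofRiemannian g) g' f x
          (Vbar (f x))) lam ↔
      ∀ (x : M) (u v : TangentSpace (𝓡 n) x),
        (SemiRiemannian.Metric.ofRiemannian g).ricci x u v =
          -(σ (f x) - lam x) * g.inner x u v
            - g'.inner (f x) (N x) (N x) * SemiRiemannian.angleFunction g' f N Vbar x *
              g.inner x
                (SemiRiemannian.weingarten (SemiRiemannian.Metric.ofRiemannian g) g' f N x u) v := by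
  have hdim : Module.finrank ℝ (EuclideanSpace ℝ (Fin (n + 1)))
      = Module.finrank ℝ (EuclideanSpace ℝ (Fin n)) + 1 := by simp
  have key := hV.half_lieDeriv_tangentialPart hf hN hdim
  constructor
  · intro h x u v
    have h1 := h.ricci_add_lieDeriv x u v
    rw [key x u v] at h1
    -- `g.inner` is definitionally the scalar product of `Metric.ofRiemannian g`; one common form
    -- lets `linarith` match the terms.
    change _ = _ * (SemiRiemannian.Metric.ofRiemannian g).inner x u v
      - _ * (SemiRiemannian.Metric.ofRiemannian g).inner x _ v
    linarith
  · intro h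
    -- The smoothness demanded of a soliton field holds for every tangential part of a smooth field,
    -- whatever the curvature equation.
    refine ⟨hf.contMDiff_tangentialPart hV.contMDiff_field, fun x u v ↦ ?_⟩
    have h1 : _ = _ * (SemiRiemannian.Metric.ofRiemannian g).inner x u v
      - _ * (SemiRiemannian.Metric.ofRiemannian g).inner x _ v := h x u v
    rw [key x u v]
    linarith
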